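/- Recall that $\diamondsuit$ is the assertion that there is a sequence $\langle A_\alpha \mid \alpha<\omega_1\rangle$ with $A_\alpha\subseteq\alpha$ for every $\alpha<\omega_1$ such that, for every $A\subseteq\omega_1$, the set $\{\alpha<\omega_1 \mid A\cap\alpha=A_\alpha\}$ is stationary in $\omega_1$. A (simple, undirected) graph $G=(\omega_1,E)$ is a Hajnal–Máté graph if, for every $\beta<\omega_1$, the set $\{\alpha<\beta \mid \{\alpha,\beta\}\in E\}$ is either finite or a set of order type $\omega$ converging to $\beta$ (that is, with supremum $\beta$). For a graph $G$ with infinite chromatic number $\chi(G)$ and $k\in\mathbb{N}$, let $f_G(k)$ be the least natural number $m$ for which there is a subgraph of $G$ with exactly $m$ vertices and chromatic number at least $k$ (such an $m$ exists by the De Bruijn–Erdős theorem). Theorem B. Suppose that $\diamondsuit$ holds. Then, for every function $f:\mathbb{N}\to\mathbb{N}$, there is a Hajnal–Máté graph $G$ on $\omega_1$ such that $|G|=\chi(G)=\aleph_1$ (where $|G|$ is the number of vertices of $G$) and, for every natural number $k\ge 3$, $f_G(k)\ge f(k)$. -/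

import Mathlib

open scoped Cardinal Ordinal

/-- The ordinal `ω₁`, as the well-ordered type of all countable ordinals. -/
abbrev OmegaOne : Type := (Ordinal.omega.{0} 1).ToType

/-- The principle `◇`: there is a sequence `⟨A_α | α < ω₁⟩` with `A_α ⊆ α` such that for every
`X ⊆ ω₁` the set of `α < ω₁` with `X ∩ α = A_α` is stationary. The ordinal `α`, as a set of
ordinals, is `Set.Iio α`. -/
def Diamond : Prop :=
  ∃ A : OmegaOne → Set OmegaOne,
    (∀ α, A α ⊆ Set.Iio α) ∧
    ∀ X : Set OmegaOne, IsStationary {α : OmegaOne | X ∩ Set.Iio α = A α}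

/-- The set of smaller neighbours `{α < β | {α, β} ∈ E}` of a vertex `β`. -/
def smallerNeighbors (G : SimpleGraph OmegaOne) (β : OmegaOne) : Set OmegaOne :=
  {α | α < β ∧ G.Adj α β}

/-- A graph on `ω₁` is a Hajnal–Máté graph if each set of smaller neighbours of a vertex `β` is
either finite or of order type `ω` and converging to `β` (that is, with supremum `β`). -/
def IsHajnalMate (G : SimpleGraph OmegaOne) : Prop :=
  ∀ β : OmegaOne,
    (smallerNeighbors G β).Finite ∨
      (Ordinal.type (fun x y : smallerNeighbors G β => x < y) = Ordinal.omega0 ∧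
        IsLUB (smallerNeighbors G β) β)

/-- The chromatic number of a graph as a cardinal: the least cardinality of a set of colours
that admits a proper colouring. (Mathlib's `SimpleGraph.chromaticNumber` takes values in `ℕ∞` and
does not distinguish infinite cardinals.) -/
noncomputable def cardinalChromaticNumber {V : Type} (G : SimpleGraph V) : Cardinal.{0} :=
  sInf {κ : Cardinal.{0} | ∃ C : Type, #C = κ ∧ Nonempty (G.Coloring C)}

/-- The function `f_G`: `leastSubgraphSize G k` is the least natural number `m` for which there is
a subgraph of `G` with exactly `m` vertices and chromatic number at least `k`. -/
noncomputable def leastSubgraphSize {V : Type} (G : SimpleGraph V) (k : ℕ) : ℕ :=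
  sInf {m : ℕ | ∃ H : G.Subgraph, #H.verts = (m : Cardinal) ∧
    (k : Cardinal) ≤ cardinalChromaticNumber H.coe}

/-!
The principle `◇` is used to guess, at each `β < ω₁`, a colouring of `β` with countably many colours
together with a sequence `z β : ℕ → ω₁`. Below `β` a ladder is built whose rung with label `j`
is an `α < β` that has the colour `j` in the guessed colouring, and whose sequence `z α` is
interlaced with `z β` on the first `N j + 1` terms. The rung with label `j` is moreover taken above
each of the finitely many `γ < β` with index at most `j` in a fixed enumeration of `β`, so an
infinite ladder converges to `β`, and the graph whose edges are the rungs is a Hajnal–Máté graph.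

*Uncountable chromatic number.* Let `c` be a colouring of `ω₁` with countably many colours. For each
sequence `Z`, the guesses are correct and equal to `Z` at stationarily many `β`, and some colour
`d Z` is taken by stationarily many of these. A colouring `d` of all sequences with countably many
colours has two sequences `X`, `Y` of the same colour `j` that are interlaced up to `N j`
(`exists_interlaced_of_coloring`): otherwise no colour class is big in the sense of iterated
"unboundedly many" quantifiers, and a sequence avoiding all classes can be chosen term by term. At
a limit `β` of vertices `α` with `z α = X`, `c α = j`, having itself `z β = Y` and `c β = j`, the
rung with label `j` exists and joins two vertices of colour `j`
(`Diamond.exists_isLadderSystem`).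

*Small subgraphs.* The rungs with one fixed label form a forest, because every vertex has at most
one smaller neighbour along them. Rungs with labels at least `n` join vertices with interlaced
sequences. Traversing such an edge upwards halves the index in a comparison of terms, and
traversing it downwards doubles it; a short closed walk with different numbers of up-steps and
down-steps would give `z u i < z u i` (`not_odd_length_of_interlaced`). Hence these rungs form a
bipartite graph on any small set of vertices, and a small subgraph has a proper colouring with
`2 ^ (n + 1)` colours (`IsLadderSystem.cardinalChromaticNumber_subgraph_le`). Choosing `N` to grow
fast relative to `f` gives the theorem, the finite subgraphs of large chromatic number being
provided by the De Bruijn–Erdős theorem.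
-/

/-! ### Countable ordinals and closed unbounded sets -/

instance nonempty_omegaOne : Nonempty OmegaOne :=
  Ordinal.nonempty_toType_iff.2 (by simp [Ordinal.omega_pos 1 |>.ne'])

theorem mk_omegaOne : #OmegaOne = ℵ₁ := by
  rw [Cardinal.mk_toType, Ordinal.card_omega]

theorem countable_Iio_omegaOne (β : OmegaOne) : (Set.Iio β).Countable := by
  rw [← Cardinal.le_aleph0_iff_set_countable, ← Order.lt_succ_iff, Cardinal.succ_aleph0,
    ← mk_omegaOne]
  refine Cardinal.mk_Iio_lt β ?_
  rw [mk_omegaOne, Ordinal.type_toType, Cardinal.ord_aleph]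

theorem exists_gt_of_countable {s : Set OmegaOne} (hs : s.Countable) : ∃ β, ∀ α ∈ s, α < β := by
  by_contra! h
  have huniv : (Set.univ : Set OmegaOne) = ⋃ α ∈ s, (insert α (Set.Iio α)) := by
    ext β
    obtain ⟨α, hα, hβα⟩ := h β
    simpa using ⟨α, hα, hβα.eq_or_lt⟩
  have hc : (Set.univ : Set OmegaOne).Countable := by
    rw [huniv]
    exact hs.biUnion fun α _ => (countable_Iio_omegaOne α).insert α
  rw [← Cardinal.le_aleph0_iff_set_countable, Cardinal.mk_univ, mk_omegaOne] at hc
  exact Cardinal.aleph0_lt_aleph_one.not_ge hc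

theorem cof_omegaOne_ne_aleph0 : Order.cof OmegaOne ≠ ℵ₀ := by
  rw [Ordinal.cof_toType, Cardinal.cof_omega_one]
  exact Cardinal.aleph0_lt_aleph_one.ne'

theorem isClub_closurePoints (h : OmegaOne → OmegaOne) (γ₀ : OmegaOne) :
    IsClub {β : OmegaOne | γ₀ < β ∧ ∀ γ < β, h γ < β} := by
  refine ⟨fun d hd hne _ a ha => ?_, fun δ => ?_⟩
  · obtain ⟨b, hb⟩ := hne
    refine ⟨(hd hb).1.trans_le (ha.1 hb), fun γ hγ => ?_⟩
    obtain ⟨b', hb', hγb'⟩ := (lt_isLUB_iff ha).1 hγ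
    exact ((hd hb').2 γ hγb').trans_le (ha.1 hb')
  · -- Iterate an upper bound for `h` on initial segments, and take the supremum.
    have hstep : ∀ γ : OmegaOne, ∃ η, γ < η ∧ ∀ α < γ, h α < η := fun γ => by
      obtain ⟨η, hη⟩ := exists_gt_of_countable
        (((countable_Iio_omegaOne γ).image h).insert γ)
      exact ⟨η, hη γ (by simp), fun α hα => hη _ (Set.mem_insert_of_mem _ ⟨α, hα, rfl⟩)⟩
    choose g hg hhg using hstep
    let b : ℕ → OmegaOne := fun n => g^[n] (max γ₀ δ)
    have hb : ∀ n, b (n + 1) = g (b n) := fun n => Function.iterate_succ_apply' g n _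
    obtain ⟨β₀, hβ₀⟩ := exists_gt_of_countable (Set.countable_range b)
    obtain ⟨β, hβ, hmin⟩ := WellFounded.has_min (wellFounded_lt (α := OmegaOne))
      (upperBounds (Set.range b)) ⟨β₀, fun α hα => (hβ₀ α hα).le⟩
    have hb0 : max γ₀ δ ≤ β := hβ ⟨0, rfl⟩
    have hlt : ∀ n, b n < β := fun n => (hg _).trans_le (hb n ▸ hβ ⟨n + 1, rfl⟩)
    refine ⟨β, ⟨(le_max_left _ _).trans_lt (hlt 0), fun γ hγ => ?_⟩, (le_max_right _ _).trans hb0⟩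
    obtain ⟨n, hn⟩ : ∃ n, γ < b n := by
      by_contra! hcon
      exact hmin γ (by rintro _ ⟨n, rfl⟩; exact hcon n) hγ
    exact (hhg _ γ hn).trans (hb n ▸ hlt (n + 1))

/-! ### Guessing colourings together with countable sequences -/

/-- `◇` guesses a colouring and a countable sequence simultaneously: `z β` is the sequence guessed
at `β`, and `col β α j` says that the colouring guessed at `β` gives `α` the colour `j`. -/
theorem Diamond.exists_guess (hD : Diamond) :
    ∃ (z : OmegaOne → ℕ → OmegaOne) (col : OmegaOne → OmegaOne → ℕ → Prop),
      ∀ (c : OmegaOne → ℕ) (Z : ℕ → OmegaOne),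
        IsStationary {β | z β = Z ∧ ∀ α < β, ∀ j, col β α j ↔ c α = j} := by
  classical
  obtain ⟨A, -, hA⟩ := hD
  obtain ⟨e⟩ : Nonempty (OmegaOne × ℕ × Bool ↪ OmegaOne) := by
    rw [← Cardinal.le_def]
    simp [Cardinal.aleph0_lt_aleph_one.le]
  refine ⟨fun β n => if h : ∃ α < β, e (α, n, true) ∈ A β then h.choose else β,
    fun β α j => e (α, j, false) ∈ A β, fun c Z => ?_⟩
  let X : Set OmegaOne :=
    Set.range (fun α => e (α, c α, false)) ∪ Set.range (fun n => e (Z n, n, true))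
  obtain ⟨γ₀, hγ₀⟩ := exists_gt_of_countable (Set.countable_range Z)
  have hh : ∀ α : OmegaOne, ∃ η, ∀ p : ℕ × Bool, e (α, p) < η := fun α => by
    obtain ⟨η, hη⟩ := exists_gt_of_countable (Set.countable_range fun p : ℕ × Bool => e (α, p))
    exact ⟨η, fun p => hη _ ⟨p, rfl⟩⟩
  choose h hh using hh
  have hX0 : ∀ α j, e (α, j, false) ∈ X ↔ c α = j := by
    simp [X, e.injective.eq_iff]
  have hX1 : ∀ α n, e (α, n, true) ∈ X ↔ Z n = α := by
    simp [X, e.injective.eq_iff]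
  intro t ht
  obtain ⟨β, hβ, hβt, hβ₀, hβh⟩ :=
    hA X (ht.inter cof_omegaOne_ne_aleph0 (isClub_closurePoints h γ₀))
  have hmem : ∀ α < β, ∀ p, e (α, p) ∈ A β ↔ e (α, p) ∈ X := fun α hα p => by
    rw [← show X ∩ Set.Iio β = A β from hβ]
    exact and_iff_left ((hh α p).trans (hβh α hα))
  refine ⟨β, ⟨funext fun n => ?_, fun α hα j => (hmem α hα _).trans (hX0 α j)⟩, hβt⟩
  have hZ : Z n < β := (hγ₀ _ ⟨n, rfl⟩).trans hβ₀
  have hex : ∃ α < β, e (α, n, true) ∈ A β := ⟨Z n, hZ, by rw [hmem _ hZ, hX1]⟩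
  simp only [dif_pos hex]
  have hs := hex.choose_spec
  rw [hmem _ hs.1, hX1] at hs
  exact hs.2.symm

/-! ### Interlaced sequences -/

/-- The first `n + 1` terms of `x` and `y` are interlaced, with `y k` directly above `x (2 * k)`.
Doubling the index makes a step from `y` to `x` and a step from `x` to `y` act on indices as
multiplication and division by two. -/
def Interlaced {α : Type*} [LT α] (n : ℕ) (x y : ℕ → α) : Prop :=
  ∀ i ≤ n, ∀ k ≤ n, (i ≤ 2 * k → x i < y k) ∧ (2 * k < i → y k < x i)

/-- The sequence `a, s 0, s 1, …`. -/
def seqCons {α : Type*} (a : α) (s : ℕ → α) : ℕ → α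
  | 0 => a
  | n + 1 => s n

theorem seqCons_tail {α : Type*} (s : ℕ → α) : seqCons (s 0) (fun i => s (i + 1)) = s := by
  funext n
  cases n <;> rfl

/-- Unboundedly many `s 0`, then unboundedly many `s 1`, and so on up to `s (n - 1)`, extend to a
sequence `s` in `P`. -/
def IsBig {α : Type*} [LT α] : ℕ → Set (ℕ → α) → Prop
  | 0, P => P.Nonempty
  | n + 1, P => ∀ γ, ∃ a, γ < a ∧ IsBig n (seqCons a ⁻¹' P)

theorem IsBig.exists_lt {α : Type*} [LinearOrder α] {n : ℕ} {P : Set (ℕ → α)} (hP : IsBig n P)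
    (γ : α) : ∃ x ∈ P, ∀ i < n, γ < x i := by
  induction n generalizing P γ with
  | zero => exact ⟨hP.some, hP.some_mem, by simp⟩
  | succ n ih =>
    obtain ⟨a, hγa, ha⟩ := hP γ
    obtain ⟨x, hx, hax⟩ := ih ha a
    refine ⟨seqCons a x, hx, fun i hi => ?_⟩
    cases i with
    | zero => exact hγa
    | succ i => exact hγa.trans (hax i (by omega))

/-- Two big sets contain sequences whose initial terms are in any prescribed relative order: `x i`
and `y k` are compared as the times `t i` and `u k` at which they are chosen. -/
theorem IsBig.exists_shuffle {α : Type*} [LinearOrder α] (m : ℕ) {a b : ℕ} (hm : a + b = m)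
    {P Q : Set (ℕ → α)} (hP : IsBig a P) (hQ : IsBig b Q) {t u : ℕ → ℕ} (ht : StrictMono t)
    (hu : StrictMono u) (htu : ∀ i k, t i ≠ u k) (γ : α) :
    ∃ x ∈ P, ∃ y ∈ Q, (∀ i < a, γ < x i) ∧ (∀ k < b, γ < y k) ∧
      ∀ i < a, ∀ k < b, (t i < u k → x i < y k) ∧ (u k < t i → y k < x i) := by
  induction m generalizing a b P Q t u γ with
  | zero =>
    obtain ⟨rfl, rfl⟩ : a = 0 ∧ b = 0 := by omega
    exact ⟨hP.some, hP.some_mem, hQ.some, hQ.some_mem, by simp⟩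
  | succ m ih =>
    rcases a with _ | a
    · obtain ⟨y, hy, hγy⟩ := hQ.exists_lt γ
      exact ⟨hP.some, hP.some_mem, y, hy, by simp, hγy, by simp⟩
    rcases b with _ | b
    · obtain ⟨x, hx, hγx⟩ := hP.exists_lt γ
      exact ⟨x, hx, hQ.some, hQ.some_mem, hγx, by simp, by simp⟩
    rcases lt_or_gt_of_ne (htu 0 0) with h0 | h0
    · obtain ⟨p, hγp, hp⟩ := hP γ
      obtain ⟨x, hx, y, hy, hpx, hpy, hxy⟩ := ih (by omega) hp hQ
        (ht.comp (strictMono_id.add_const 1)) hu (fun i k => htu _ k) p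
      refine ⟨seqCons p x, hx, y, hy, fun i hi => ?_, fun k hk => hγp.trans (hpy k hk),
        fun i hi k hk => ?_⟩
      · cases i with
        | zero => exact hγp
        | succ i => exact hγp.trans (hpx i (by omega))
      · cases i with
        | zero =>
          refine ⟨fun _ => hpy k hk, fun h => absurd h (h0.trans_le ?_).not_gt⟩
          exact hu.monotone (Nat.zero_le k)
        | succ i => exact hxy i (by omega) k hk
    · obtain ⟨p, hγp, hp⟩ := hQ γ
      obtain ⟨x, hx, y, hy, hpx, hpy, hxy⟩ := ih (by omega) hP hp
        ht (hu.comp (strictMono_id.add_const 1)) (fun i k => htu i _) p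
      refine ⟨x, hx, seqCons p y, hy, fun i hi => hγp.trans (hpx i hi), fun k hk => ?_,
        fun i hi k hk => ?_⟩
      · cases k with
        | zero => exact hγp
        | succ k => exact hγp.trans (hpy k (by omega))
      · cases k with
        | zero =>
          refine ⟨fun h => absurd h (h0.trans_le ?_).not_gt, fun _ => hpx i hi⟩
          exact ht.monotone (Nat.zero_le i)
        | succ k => exact hxy i hi k (by omega)

/-- Countably many sets of sequences that are not big do not cover: choose the terms one after
the other, each beyond countably many bounds. -/
theorem exists_forall_notMem_of_not_isBig {P : ℕ → Set (ℕ → OmegaOne)} {l : ℕ → ℕ}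
    (hP : ∀ j, ¬ IsBig (l j) (P j)) : ∃ s, ∀ j, s ∉ P j := by
  have hstep : ∀ (n : ℕ) (Q : ℕ → Set (ℕ → OmegaOne)), (∀ j, ¬ IsBig (l j - n) (Q j)) →
      ∃ a, ∀ j, ¬ IsBig (l j - (n + 1)) (seqCons a ⁻¹' Q j) := by
    intro n Q hQ
    have hγ : ∀ j, ∃ γ, ∀ a, γ < a → ¬ IsBig (l j - (n + 1)) (seqCons a ⁻¹' Q j) := by
      intro j
      have hj := hQ j
      rcases hl : l j - n with _ | m
      · rw [hl] at hj
        have h0 : l j - (n + 1) = 0 := by omega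
        refine ⟨Classical.arbitrary _, fun a _ h => ?_⟩
        rw [h0] at h
        exact hj ⟨_, h.some_mem⟩
      · rw [hl] at hj
        have h0 : l j - (n + 1) = m := by omega
        simpa [IsBig, h0] using hj
    choose γ hγ using hγ
    obtain ⟨a, ha⟩ := exists_gt_of_countable (Set.countable_range γ)
    exact ⟨a, fun j => hγ j a (ha _ ⟨j, rfl⟩)⟩
  choose! g hg using hstep
  -- The sets of tails that continue the first `n` chosen terms to a member of `P j`.
  let F : ℕ → ℕ → Set (ℕ → OmegaOne) :=
    fun n => Nat.rec P (fun n Q j => seqCons (g n Q) ⁻¹' Q j) n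
  have hF : ∀ n j, ¬ IsBig (l j - n) (F n j) := by
    intro n
    induction n with
    | zero => exact hP
    | succ n ih => exact hg n (F n) ih
  let s : ℕ → OmegaOne := fun n => g n (F n)
  have htail : ∀ j n, s ∈ P j → (fun i => s (n + i)) ∈ F n j := by
    intro j n hs
    induction n with
    | zero =>
      change (fun i => s (0 + i)) ∈ P j
      simpa only [Nat.zero_add] using hs
    | succ n ih =>
      change seqCons (s n) _ ∈ F n j
      convert ih using 1
      rw [← seqCons_tail fun i => s (n + i)]
      congr 1
      funext i
      congr 1
      omega
  refine ⟨s, fun j hs => hF (l j) j ?_⟩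
  rw [Nat.sub_self]
  exact ⟨_, htail j _ hs⟩

/-- In every colouring of the sequences with countably many colours, some colour `j` contains two
sequences that are interlaced for as long as `N j` requires. -/
theorem exists_interlaced_of_coloring (d : (ℕ → OmegaOne) → ℕ) (N : ℕ → ℕ) :
    ∃ x y, d x = d y ∧ Interlaced (N (d y)) x y := by
  obtain ⟨j, hj⟩ : ∃ j, IsBig (N j + 1) {s | d s = j} := by
    by_contra! h
    obtain ⟨s, hs⟩ := exists_forall_notMem_of_not_isBig h
    exact hs (d s) rfl
  obtain ⟨x, hx, y, hy, -, -, hxy⟩ := IsBig.exists_shuffle _ rfl hj hj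
    (t := fun i => 2 * i) (u := fun k => 4 * k + 1) (fun _ _ _ => by dsimp; omega)
    (fun _ _ _ => by dsimp; omega) (fun _ _ => by omega) (Classical.arbitrary _)
  simp only [Set.mem_ofPred_eq] at hx hy
  refine ⟨x, y, hx.trans hy.symm, fun i hi k hk => ?_⟩
  rw [hy] at hi hk
  obtain ⟨h1, h2⟩ := hxy i (by omega) k (by omega)
  exact ⟨fun h => h1 (by omega), fun h => h2 (by omega)⟩

/-! ### Ladders -/

/-- A system of ladders on `ω₁`: `R β j α` says that `α` is the rung of the ladder below `β` with
label `j`. The rungs of `β` with large labels lie above any given `γ < β`, the sequences attached to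
the two ends of a rung are interlaced to the extent prescribed by its label, and every colouring
with countably many colours is constant on some rung. -/
structure IsLadderSystem (N : ℕ → ℕ) (z : OmegaOne → ℕ → OmegaOne)
    (R : OmegaOne → ℕ → OmegaOne → Prop) : Prop where
  unique : ∀ {β j α α'}, R β j α → R β j α' → α = α'
  lt : ∀ {β j α}, R β j α → α < β
  converges : ∀ {β γ}, γ < β → ∃ m, ∀ j α, m ≤ j → R β j α → γ < α
  interlaced : ∀ {β j α}, R β j α → Interlaced (N j) (z α) (z β)
  monochromatic : ∀ c : OmegaOne → ℕ, ∃ β j α, R β j α ∧ c α = c β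

theorem Diamond.exists_isLadderSystem (hD : Diamond) (N : ℕ → ℕ) :
    ∃ z R, IsLadderSystem N z R := by
  obtain ⟨z, col, hguess⟩ := hD.exists_guess
  -- `code β` enumerates the predecessors of `β`.
  have hcode : ∀ β : OmegaOne, ∃ code : OmegaOne → ℕ, Set.InjOn code (Set.Iio β) :=
    fun β => Set.countable_iff_exists_injOn.1 (countable_Iio_omegaOne β)
  choose code hcode using hcode
  let Good : OmegaOne → ℕ → OmegaOne → Prop := fun β j α =>
    α < β ∧ (∀ γ < β, code β γ ≤ j → γ < α) ∧ Interlaced (N j) (z α) (z β) ∧ col β α j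
  let R : OmegaOne → ℕ → OmegaOne → Prop := fun β j α => ∃ h : ∃ α, Good β j α, α = h.choose
  have hR : ∀ {β j α}, R β j α → Good β j α := by
    rintro β j _ ⟨h, rfl⟩
    exact h.choose_spec
  refine ⟨z, R, ?_, fun h => (hR h).1, fun {β γ} hγ => ⟨code β γ, fun j α hj h =>
    (hR h).2.1 γ hγ hj⟩, fun h => (hR h).2.2.1, fun c => ?_⟩
  · rintro β j _ _ ⟨_, rfl⟩ ⟨_, rfl⟩
    rfl
  · have hcol : ∀ Z, ∃ j, IsStationary
        {β | (z β = Z ∧ ∀ α < β, ∀ j, col β α j ↔ c α = j) ∧ c β = j} := by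
      intro Z
      rw [← isStationary_iUnion_iff_of_countable cof_omegaOne_ne_aleph0]
      refine (hguess c Z).mono fun β hβ => Set.mem_iUnion.2 ⟨c β, hβ, rfl⟩
    choose d hd using hcol
    obtain ⟨X, Y, hXY, hint⟩ := exists_interlaced_of_coloring d N
    have hunb : ∀ γ, ∃ α, γ < α ∧ z α = X ∧ c α = d X := by
      intro γ
      obtain ⟨α, hα, hγα, -⟩ := hd X (isClub_closurePoints id γ)
      exact ⟨α, hγα, hα.1.1, hα.2⟩
    choose h hlt hz hc using hunb
    obtain ⟨β, ⟨⟨hzβ, hcolβ⟩, hcβ⟩, hβ₀, hβ⟩ :=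
      hd Y (isClub_closurePoints h (Classical.arbitrary _))
    have hfin : {γ | γ < β ∧ code β γ ≤ d Y}.Finite :=
      Set.Finite.of_finite_image ((Set.finite_Iic (d Y)).subset (by
        rintro _ ⟨γ, hγ, rfl⟩
        exact hγ.2)) ((hcode β).mono fun γ hγ => hγ.1)
    obtain ⟨δ, hδβ, hδ⟩ : ∃ δ < β, ∀ γ < β, code β γ ≤ d Y → γ ≤ δ := by
      rcases Set.eq_empty_or_nonempty {γ | γ < β ∧ code β γ ≤ d Y} with he | hne
      · exact ⟨_, hβ₀, fun γ hγ hj => (Set.eq_empty_iff_forall_notMem.1 he γ ⟨hγ, hj⟩).elim⟩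
      · obtain ⟨δ, hδ, hmax⟩ := Set.exists_max_image _ id hfin hne
        exact ⟨δ, hδ.1, fun γ hγ hj => hmax γ ⟨hγ, hj⟩⟩
    have hex : ∃ α, Good β (d Y) α :=
      ⟨h δ, hβ δ hδβ, fun γ hγ hj => (hδ γ hγ hj).trans_lt (hlt δ), by rw [hz, hzβ]; exact hint,
        (hcolβ _ (hβ δ hδβ) _).2 ((hc δ).trans hXY)⟩
    have hgood := hex.choose_spec
    exact ⟨β, d Y, hex.choose, ⟨hex, rfl⟩, ((hcolβ _ hgood.1 _).1 hgood.2.2.2).trans hcβ.symm⟩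

/-! ### Odd closed walks and interlaced sequences -/

/-- The number of steps of a walk that go up in the order of the vertices. -/
def upSteps {V : Type*} [LinearOrder V] {G : SimpleGraph V} {u v : V} (w : G.Walk u v) : ℕ :=
  w.darts.countP fun d => d.fst < d.snd

theorem upSteps_add_upSteps_reverse {V : Type*} [LinearOrder V] {G : SimpleGraph V} {u v : V}
    (w : G.Walk u v) : upSteps w + upSteps w.reverse = w.length := by
  rw [upSteps, upSteps, SimpleGraph.Walk.darts_reverse, List.countP_reverse, List.countP_map,
    ← SimpleGraph.Walk.length_darts,
    List.length_eq_countP_add_countP (fun d : G.Dart => decide (d.fst < d.snd))]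
  congr 1
  refine List.countP_congr fun d _ => ?_
  have := d.adj.ne
  simp only [Function.comp_apply, SimpleGraph.Dart.symm, decide_eq_true_eq, Prod.fst_swap,
    Prod.snd_swap, not_lt]
  exact ⟨fun h => (of_decide_eq_true h).le, fun h => decide_eq_true (lt_of_le_of_ne h this.symm)⟩

theorem upSteps_cons {V : Type*} [LinearOrder V] {G : SimpleGraph V} {u v w : V}
    (h : G.Adj u v) (p : G.Walk v w) :
    upSteps (p.cons h) = upSteps p + if u < v then 1 else 0 := by
  simp [upSteps, List.countP_cons]

/-- Along a walk, up-steps halve the index and down-steps double it. Starting from the index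
`2 ^ a * k`, the loss due to strict inequalities is absorbed by decreasing `k` once per step. -/
theorem lt_of_walk {V α : Type*} [LinearOrder V] [LinearOrder α] {G : SimpleGraph V}
    {z : V → ℕ → α} {M : ℕ} (hz : ∀ u v, u < v → G.Adj u v → Interlaced M (z u) (z v))
    {u v : V} (w : G.Walk u v) (a k j p q : ℕ) (hw : 1 ≤ w.length) (hp : upSteps w = p)
    (hq : p + q = w.length) (ha : w.length ≤ a) (hk : w.length < k)
    (hM : 2 ^ (a + w.length) * k ≤ M) (hj : j * 2 ^ p ≤ 2 ^ (a + q) * (k - w.length)) :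
    z v j < z u (2 ^ a * k) := by
  induction w generalizing a k j p q with
  | nil => simp at hw
  | @cons u u' v h w ih =>
    rw [upSteps_cons] at hp
    simp only [SimpleGraph.Walk.length_cons] at hq ha hk hM hj
    have hi : 2 ^ a * k ≤ M := le_trans (by gcongr <;> omega) hM
    rcases lt_or_gt_of_ne h.ne with hlt | hlt
    · -- an up-step
      rw [if_pos hlt] at hp
      obtain ⟨a, rfl⟩ : ∃ b, a = b + 1 := ⟨a - 1, by omega⟩
      obtain ⟨k, rfl⟩ : ∃ b, k = b + 1 := ⟨k - 1, by omega⟩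
      obtain ⟨p, rfl⟩ : ∃ b, p = b + 1 := ⟨p - 1, by omega⟩
      have hstep : ∀ i, i ≤ 2 ^ a * k → z u' i < z u (2 ^ (a + 1) * (k + 1)) := fun i hik => by
        have h2 : 2 * i < 2 ^ (a + 1) * (k + 1) := by
          have := Nat.pos_of_ne_zero (pow_ne_zero a two_ne_zero : (2 : ℕ) ^ a ≠ 0)
          rw [pow_succ]
          nlinarith
        exact (hz u u' hlt h _ hi _ (by omega)).2 h2
      rcases Nat.eq_zero_or_pos w.length with h0 | hpos
      · obtain rfl := SimpleGraph.Walk.eq_of_length_eq_zero h0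
        refine hstep j ?_
        obtain ⟨rfl, rfl⟩ : p = 0 ∧ q = 0 := by omega
        rw [h0] at hj
        simp only [zero_add, add_zero, pow_succ, Nat.add_sub_cancel] at hj
        linarith
      · refine lt_trans (ih a k j p q hpos (by omega) (by omega) (by omega) (by omega) ?_ ?_)
          (hstep _ le_rfl)
        · refine le_trans ?_ hM
          gcongr <;> omega
        · rw [show k + 1 - (w.length + 1) = k - w.length by omega, pow_succ,
            show a + 1 + q = a + q + 1 by omega, pow_succ] at hj
          linarith
    · -- a down-step
      rw [if_neg hlt.not_gt] at hp
      obtain ⟨k, rfl⟩ : ∃ b, k = b + 1 := ⟨k - 1, by omega⟩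
      have hp' : p ≤ w.length := by
        have := upSteps_add_upSteps_reverse w
        omega
      obtain ⟨q, rfl⟩ : ∃ b, q = b + 1 := ⟨q - 1, by omega⟩
      have hM' : 2 ^ (a + 1 + w.length) * k ≤ M := by
        refine le_trans ?_ hM
        rw [show a + 1 + w.length = a + (w.length + 1) by omega]
        gcongr
        omega
      have hstep : ∀ i, i ≤ 2 ^ (a + 1) * k → z u' i < z u (2 ^ a * (k + 1)) := fun i hik => by
        have hiM : i ≤ M := 
          hik.trans ((Nat.mul_le_mul_right k (Nat.pow_le_pow_right two_pos (by omega))).trans hM')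
        refine (hz u' u hlt h.symm _ hiM _ hi).1 ?_
        rw [pow_succ] at hik
        nlinarith
      rcases Nat.eq_zero_or_pos w.length with h0 | hpos
      · obtain rfl := SimpleGraph.Walk.eq_of_length_eq_zero h0
        refine hstep j ?_
        obtain ⟨rfl, rfl⟩ : p = 0 ∧ q = 0 := by omega
        simpa [h0] using hj
      · refine lt_trans (ih (a + 1) k j p q hpos (by omega) (by omega) (by omega) (by omega) hM'
          ?_) (hstep _ le_rfl)
        rw [show k + 1 - (w.length + 1) = k - w.length by omega] at hj
        rwa [show a + 1 + q = a + (q + 1) by omega]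

theorem not_odd_length_of_interlaced {V α : Type*} [LinearOrder V] [LinearOrder α]
    {G : SimpleGraph V} {z : V → ℕ → α} {M : ℕ}
    (hz : ∀ u v, u < v → G.Adj u v → Interlaced M (z u) (z v)) {u : V} (w : G.Walk u u)
    (hM : 4 ^ w.length * (2 * w.length) ≤ M) : ¬ Odd w.length := by
  intro hodd
  -- A closed walk with more down-steps than up-steps increases the index.
  have key : ∀ w' : G.Walk u u, w'.length = w.length → upSteps w' < upSteps w'.reverse →
      False := by
    intro w' hl hlt
    have hadd := upSteps_add_upSteps_reverse w'
    have hpos := hodd.pos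
    refine lt_irrefl _ (lt_of_walk hz w' w.length (2 * w.length) (2 ^ w.length * (2 * w.length))
      _ _ (by omega) rfl hadd (by omega) (by omega) ?_ ?_)
    · rwa [hl, pow_add, ← mul_pow]
    · have h2 : 2 * 2 ^ upSteps w' ≤ 2 ^ upSteps w'.reverse := by
        rw [← pow_succ']
        exact Nat.pow_le_pow_right two_pos hlt
      rw [hl, show 2 * w.length - w.length = w.length by omega, pow_add]
      calc 2 ^ w.length * (2 * w.length) * 2 ^ upSteps w'
          = 2 ^ w.length * w.length * (2 * 2 ^ upSteps w') := by ring
        _ ≤ 2 ^ w.length * w.length * 2 ^ upSteps w'.reverse := by gcongr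
        _ = _ := by ring
  have hadd := upSteps_add_upSteps_reverse w
  rcases lt_trichotomy (upSteps w) (upSteps w.reverse) with h | h | h
  · exact key w rfl h
  · obtain ⟨m, hm⟩ := hodd
    omega
  · exact key w.reverse (by simp) (by simpa using h)

/-! ### Colouring lemmas -/

/-- The vertices are coloured by the parity of their distance from a root of their component. -/
theorem nonempty_coloring_of_short_odd_walks {V : Type*} [Fintype V] (G : SimpleGraph V)
    (h : ∀ u (w : G.Walk u u), w.length ≤ 2 * Fintype.card V → ¬ Odd w.length) :
    Nonempty (G.Coloring Prop) := by
  let r : V → V := fun v => (G.connectedComponentMk v).out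
  have hr : ∀ v, G.Reachable (r v) v := fun v =>
    SimpleGraph.ConnectedComponent.exact (Quot.out_eq (G.connectedComponentMk v))
  refine ⟨SimpleGraph.Coloring.mk (fun v => Odd (G.dist (r v) v)) fun {u v} huv heq => ?_⟩
  have hruv : r u = r v := by
    simp only [r, SimpleGraph.ConnectedComponent.sound huv.reachable]
  obtain ⟨p, hp, hpl⟩ := (hr u).exists_path_of_dist
  obtain ⟨q, hq, hql⟩ := (hr v).exists_path_of_dist
  have hpc := hp.length_lt
  have hqc := hq.length_lt
  refine h _ ((p.concat huv).append (q.reverse.copy rfl hruv.symm)) ?_ ?_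
  · simp only [SimpleGraph.Walk.length_append, SimpleGraph.Walk.length_concat,
      SimpleGraph.Walk.length_copy, SimpleGraph.Walk.length_reverse]
    omega
  · simp only [SimpleGraph.Walk.length_append, SimpleGraph.Walk.length_concat,
      SimpleGraph.Walk.length_copy, SimpleGraph.Walk.length_reverse, hpl, hql]
    have heq' : Odd (G.dist (r u) u) ↔ Odd (G.dist (r v) v) := iff_of_eq heq
    rw [Nat.odd_iff, Nat.odd_iff] at heq'
    rw [Nat.odd_iff]
    omega

/-- Along a well-order, give each vertex the colour that its only smaller neighbour, if any, does
not have. -/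
theorem exists_coloring_of_unique_smaller {V : Type*} [LinearOrder V] [WellFoundedLT V]
    (P : V → V → Prop) (hP : ∀ {β α α'}, P β α → P β α' → α = α') (hlt : ∀ {β α}, P β α → α < β) :
    ∃ c : V → Prop, ∀ {β α}, P β α → c α ≠ c β := by
  let F : (β : V) → ((α : V) → α < β → Prop) → Prop :=
    fun β ih => ¬ ∃ α, ∃ h : α < β, P β α ∧ ih α h
  let c : V → Prop := WellFounded.fix wellFounded_lt F
  have hc : ∀ β, c β ↔ ¬ ∃ α, ∃ _ : α < β, P β α ∧ c α := fun β =>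
    iff_of_eq (WellFounded.fix_eq wellFounded_lt F β)
  refine ⟨c, fun {β α} h heq => ?_⟩
  have h1 := hc β
  have h2 : (∃ α', ∃ _ : α' < β, P β α' ∧ c α') ↔ c α :=
    ⟨fun ⟨α', _, h', hc'⟩ => hP h' h ▸ hc', fun hα => ⟨α, hlt h, h, hα⟩⟩
  rw [h2, ← heq] at h1
  exact iff_not_self h1

theorem cardinalChromaticNumber_le {V C : Type} {G : SimpleGraph V} (c : G.Coloring C) :
    cardinalChromaticNumber G ≤ #C :=
  csInf_le' ⟨C, rfl, ⟨c⟩⟩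

theorem exists_coloring_mk_eq {V : Type} (G : SimpleGraph V) :
    ∃ C : Type, #C = cardinalChromaticNumber G ∧ Nonempty (G.Coloring C) :=
  csInf_mem (s := {κ : Cardinal.{0} | ∃ C : Type, #C = κ ∧ Nonempty (G.Coloring C)})
    ⟨#V, V, rfl, ⟨SimpleGraph.Coloring.mk id fun h => h.ne⟩⟩

theorem exists_coloring_of_cardinalChromaticNumber_le {V C : Type} (G : SimpleGraph V)
    (h : cardinalChromaticNumber G ≤ #C) : Nonempty (G.Coloring C) := by
  obtain ⟨D, hD, ⟨c⟩⟩ := exists_coloring_mk_eq G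
  rw [← hD] at h
  obtain ⟨e⟩ := h
  exact ⟨SimpleGraph.Coloring.mk (fun v => e (c v)) fun hv => e.injective.ne (c.valid hv)⟩

/-- By the De Bruijn–Erdős theorem the set of sizes of subgraphs of chromatic number at least `k`
is nonempty, so `leastSubgraphSize` is bounded below by any lower bound of it. -/
theorem le_leastSubgraphSize {V : Type} {G : SimpleGraph V}
    (hG : ℵ₀ ≤ cardinalChromaticNumber G) {k m : ℕ}
    (h : ∀ H : G.Subgraph, H.verts.Finite → Nat.card H.verts < m →
      cardinalChromaticNumber H.coe < k) : m ≤ leastSubgraphSize G k := by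
  refine le_csInf ?_ ?_
  · by_contra hne
    rw [Set.not_nonempty_iff_eq_empty, Set.eq_empty_iff_forall_notMem] at hne
    have hfin : ∀ H : G.Subgraph, H.verts.Finite →
        Nonempty (H.coe →g (⊤ : SimpleGraph (Fin k))) := by
      intro H hH
      have := hH.fintype
      refine exists_coloring_of_cardinalChromaticNumber_le _ ?_
      rw [Cardinal.mk_fin]
      by_contra hk
      exact hne (Fintype.card H.verts) ⟨H, Cardinal.mk_fintype _, (not_le.1 hk).le⟩
    obtain ⟨c⟩ := SimpleGraph.nonempty_hom_of_forall_finite_subgraph_hom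
      fun H hH => (hfin H hH).some
    have := hG.trans (cardinalChromaticNumber_le (C := Fin k) c)
    rw [Cardinal.mk_fin] at this
    exact Cardinal.natCast_lt_aleph0.not_ge this
  · rintro n ⟨H, hn, hk⟩
    by_contra! hnm
    have hfin : H.verts.Finite := by
      rw [← Cardinal.lt_aleph0_iff_set_finite, hn]
      exact Cardinal.natCast_lt_aleph0
    refine (h H hfin ?_).not_ge hk
    rwa [Nat.card, hn, Cardinal.toNat_natCast]

/-! ### The graph of a ladder system -/

theorem type_eq_omega0_of_finite_initial {s : Set OmegaOne} (hs : s.Infinite)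
    (hfin : ∀ β ∈ s, {α ∈ s | α < β}.Finite) :
    Ordinal.type (fun x y : s => x < y) = Ordinal.omega0 := by
  apply le_antisymm
  · refine le_of_forall_lt fun o ho => ?_
    obtain ⟨β, rfl⟩ := Ordinal.typein_surj (fun x y : s => x < y) ho
    rw [← Ordinal.card_lt_aleph0, Ordinal.card_typein, Cardinal.lt_aleph0_iff_finite]
    have : {y : s | y < β}.Finite :=
      Set.Finite.of_finite_image ((hfin β β.2).subset (by
        rintro _ ⟨y, hy, rfl⟩
        exact ⟨y.2, hy⟩)) Subtype.val_injective.injOn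
    exact this.to_subtype
  · rw [← Ordinal.aleph0_le_card, Ordinal.card_type, Cardinal.aleph0_le_mk_iff]
    exact hs.to_subtype

namespace IsLadderSystem

variable {N : ℕ → ℕ} {z : OmegaOne → ℕ → OmegaOne} {R : OmegaOne → ℕ → OmegaOne → Prop}

/-- The graph whose edges are the rungs with label at least `n`. -/
def graph (h : IsLadderSystem N z R) (n : ℕ) : SimpleGraph OmegaOne where
  Adj α β := ∃ j, n ≤ j ∧ (R β j α ∨ R α j β)
  symm := ⟨fun _ _ ⟨j, hj, hR⟩ => ⟨j, hj, hR.symm⟩⟩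
  loopless := ⟨fun _ ⟨_, _, hR⟩ => (h.lt (hR.elim id id)).false⟩

theorem graph_adj_of_lt (h : IsLadderSystem N z R) {n : ℕ} {α β : OmegaOne} (hαβ : α < β) :
    (h.graph n).Adj α β ↔ ∃ j, n ≤ j ∧ R β j α :=
  ⟨fun ⟨j, hj, hR⟩ => ⟨j, hj, hR.resolve_right fun hR' => (h.lt hR').asymm hαβ⟩,
    fun ⟨j, hj, hR⟩ => ⟨j, hj, .inl hR⟩⟩

theorem isHajnalMate (h : IsLadderSystem N z R) : IsHajnalMate (h.graph 0) := by
  intro β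
  have hR : ∀ α ∈ smallerNeighbors (h.graph 0) β, ∃ j, R β j α := fun α hα => by
    obtain ⟨j, -, hj⟩ := (h.graph_adj_of_lt hα.1).1 hα.2
    exact ⟨j, hj⟩
  have hfin : ∀ γ < β, {α ∈ smallerNeighbors (h.graph 0) β | α ≤ γ}.Finite := by
    intro γ hγ
    obtain ⟨m, hm⟩ := h.converges hγ
    have : {α ∈ smallerNeighbors (h.graph 0) β | α ≤ γ} ⊆ ⋃ j ∈ Set.Iio m, {α | R β j α} := by
      rintro α ⟨hα, hαγ⟩
      obtain ⟨j, hj⟩ := hR α hα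
      simp only [Set.mem_Iio, Set.mem_iUnion, exists_prop]
      exact ⟨j, not_le.1 fun hmj => (hm j α hmj hj).not_ge hαγ, hj⟩
    refine Set.Finite.subset ((Set.finite_Iio m).biUnion fun j _ => ?_) this
    exact Set.Subsingleton.finite fun _ ha _ hb => h.unique ha hb
  rcases Set.finite_or_infinite (smallerNeighbors (h.graph 0) β) with hf | hi
  · exact .inl hf
  refine .inr ⟨type_eq_omega0_of_finite_initial hi fun γ hγ => ?_, fun α hα => hα.1.le,
    fun γ hγ => ?_⟩
  · exact (hfin γ hγ.1).subset fun α hα => ⟨hα.1, hα.2.le⟩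
  · by_contra! hγβ
    exact hi ((hfin γ hγβ).subset fun α hα => ⟨hα, hγ hα⟩)

theorem cardinalChromaticNumber_graph (h : IsLadderSystem N z R) :
    cardinalChromaticNumber (h.graph 0) = ℵ₁ := by
  apply le_antisymm
  · rw [← mk_omegaOne]
    exact cardinalChromaticNumber_le (SimpleGraph.Coloring.mk id fun h => h.ne)
  · by_contra! hlt
    rw [← Cardinal.succ_aleph0, Order.lt_succ_iff, ← Cardinal.mk_nat] at hlt
    obtain ⟨c⟩ := exists_coloring_of_cardinalChromaticNumber_le _ hlt
    obtain ⟨β, j, α, hR, hc⟩ := h.monochromatic c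
    exact c.valid ((h.graph_adj_of_lt (h.lt hR)).2 ⟨j, Nat.zero_le j, hR⟩) hc

/-- The rungs with labels below `n` decompose into `n` forests. In a small subgraph, the other rungs
form no odd closed walk that is short enough to matter. -/
theorem cardinalChromaticNumber_subgraph_le (h : IsLadderSystem N z R) (n m : ℕ)
    (hN : ∀ j, n ≤ j → 4 ^ (2 * m) * (2 * (2 * m)) ≤ N j) (H : (h.graph 0).Subgraph)
    (hfin : H.verts.Finite) (hm : Nat.card H.verts ≤ m) :
    cardinalChromaticNumber H.coe ≤ (2 ^ (n + 1) : ℕ) := by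
  have := hfin.fintype
  have hforest : ∀ i, ∃ c : OmegaOne → Prop, ∀ {β α}, R β i α → c α ≠ c β := fun i =>
    exists_coloring_of_unique_smaller (fun β α => R β i α) h.unique h.lt
  choose c hc using hforest
  let L : SimpleGraph H.verts := (h.graph n).comap Subtype.val
  obtain ⟨b⟩ : Nonempty (L.Coloring Prop) := by
    refine nonempty_coloring_of_short_odd_walks L fun u w hw => ?_
    rw [← Nat.card_eq_fintype_card] at hw
    have hw' : w.length ≤ 2 * m := by omega
    rw [← SimpleGraph.Walk.length_map (SimpleGraph.Hom.comap Subtype.val (h.graph n)) w]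
    refine not_odd_length_of_interlaced (z := z) (M := 4 ^ (2 * m) * (2 * (2 * m))) ?_ _ ?_
    · intro α β hαβ hadj
      obtain ⟨j, hj, hR⟩ := (h.graph_adj_of_lt hαβ).1 hadj
      exact fun i hi k hk => h.interlaced hR i (hi.trans (hN j hj)) k (hk.trans (hN j hj))
    · rw [SimpleGraph.Walk.length_map]
      gcongr
      norm_num
  have hcol : H.coe.Coloring ((Fin n → Prop) × Prop) :=
    SimpleGraph.Coloring.mk (fun v => (fun i => c i v, b v)) fun {u v} huv heq => by
      obtain ⟨j, -, hj⟩ := H.adj_sub huv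
      rcases lt_or_ge j n with hjn | hnj
      · have heq' : c j u = c j v := congrFun (congrArg Prod.fst heq) ⟨j, hjn⟩
        rcases hj with hj | hj
        · exact hc j hj heq'
        · exact hc j hj heq'.symm
      · exact b.valid (show L.Adj u v from ⟨j, hnj, hj⟩) (congrArg Prod.snd heq)
  refine (cardinalChromaticNumber_le hcol).trans_eq ?_
  rw [Cardinal.mk_fintype]
  simp [pow_succ]

end IsLadderSystem

theorem theoremB (hDiamond : Diamond) (f : ℕ → ℕ) :
    ∃ G : SimpleGraph OmegaOne,
      IsHajnalMate G ∧
      #OmegaOne = ℵ₁ ∧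
      cardinalChromaticNumber G = ℵ₁ ∧
      ∀ k : ℕ, 3 ≤ k → f k ≤ leastSubgraphSize G k := by
  let B : ℕ → ℕ := fun m => 4 ^ (2 * m) * (2 * (2 * m))
  -- A label `j` has to respect `f k` for those `k` with `Nat.log 2 (k - 1) ≤ j + 1`.
  let N : ℕ → ℕ := fun j => ∑ k ∈ Finset.range (2 ^ (j + 2) + 1), B (f k)
  obtain ⟨z, R, h⟩ := hDiamond.exists_isLadderSystem N
  refine ⟨h.graph 0, h.isHajnalMate, mk_omegaOne, h.cardinalChromaticNumber_graph, fun k hk => ?_⟩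
  refine le_leastSubgraphSize ?_ fun H hfin hcard => ?_
  · rw [h.cardinalChromaticNumber_graph]
    exact Cardinal.aleph0_lt_aleph_one.le
  -- The largest `n` with `2 ^ (n + 1) < k`, so that `k ≤ 2 ^ (n + 2)`.
  obtain ⟨n, hn⟩ : ∃ n, Nat.log 2 (k - 1) = n + 1 :=
    ⟨Nat.log 2 (k - 1) - 1, by
      have : 0 < Nat.log 2 (k - 1) := Nat.log_pos one_lt_two (by omega)
      omega⟩
  have hlow : 2 ^ (n + 1) ≤ k - 1 := hn ▸ Nat.pow_log_le_self 2 (by omega)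
  have hhigh : k - 1 < 2 ^ (n + 2) := by
    have := Nat.lt_pow_succ_log_self one_lt_two (k - 1)
    rwa [hn] at this
  refine (h.cardinalChromaticNumber_subgraph_le n (f k) (fun j hj => ?_) H hfin hcard.le).trans_lt
    (by exact_mod_cast (by omega : 2 ^ (n + 1) < k))
  have hmem : k ∈ Finset.range (2 ^ (j + 2) + 1) := by
    have : 2 ^ (n + 2) ≤ 2 ^ (j + 2) := Nat.pow_le_pow_right two_pos (by omega)
    rw [Finset.mem_range]
    omega
  exact Finset.single_le_sum (f := fun k => B (f k)) (fun _ _ => Nat.zero_le _) hmem
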